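/- Let $F$ be a field and let $n>1$ be an integer. Let $\mathbb{P}^n_F=(F^{n+1}\setminus\{0\})/F^\times$, and for distinct points $x=[\bar x]$, $y=[\bar y]$ let $\ell(x,y)=\{[a\bar x+b\bar y]: a,b\in F^\times\}\cup\{x,y\}$ be the line through them; let $\mathcal{L}$ be the set of all lines. A collineation is a pair $(\alpha,\beta)$ of bijections $\alpha:\mathbb{P}^n_F\to\mathbb{P}^n_F$, $\beta:\mathcal{L}\to\mathcal{L}$ with $\ell(\alpha(x),\alpha(y))=\beta(\ell(x,y))$ for all distinct $x,y$; collineations form a group under composition. Let $\mathrm{P\Gamma L}(n,F)=\mathrm{PGL}(F^{n+1},F)\rtimes\mathrm{Aut}(F)$, where $\mathrm{Aut}(F)$ acts on classes of invertible matrices entry by entry. (1) The collineation group of $\mathbb{P}^n_F$ is isomorphic to $\mathrm{P\Gamma L}(n,F)$. (2) Let $\tau$ be a topology making $F$ a Hausdorff topological field (in which inversion is continuous on $F^\times$), and give $\mathbb{P}^n_F$ the quotient topology of the subspace topology on $F^{n+1}\setminus\{0\}\subseteq F^{n+1}$, where $F^{n+1}$ carries the product topology. Let $\mathrm{Aut}_\tau(F)$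 be the group of automorphisms of $F$ that are continuous with continuous inverse, and $\mathrm{P\Gamma L}_\tau(n,F)=\mathrm{PGL}(F^{n+1},F)\rtimes\mathrm{Aut}_\tau(F)$. Then the group of all collineations $(\alpha,\beta)$ such that $\alpha$ and $\alpha^{-1}$ are continuous is isomorphic to $\mathrm{P\Gamma L}_\tau(n,F)$. Moreover, without conditions on inverses, the monoid of all collineations $(\alpha,\beta)$ with $\alpha$ continuous is isomorphic to the submonoid of $\mathrm{P\Gamma L}(n,F)$ of all elements whose component in $\mathrm{Aut}(F)$ is continuous. -/

import Mathlib

open scoped LinearAlgebra.Projectivization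

noncomputable section

namespace ProjCol

/-! ### The projective geometry of a vector space -/

section Geometry

variable (K : Type*) [Field K] {V : Type*} [AddCommGroup V] [Module K V]

/-- The line `ℓ(x, y)` through two distinct points of the projective space: the points `z`
represented by `a x + b y` with `a, b` nonzero scalars, together with `x` and `y`.
(It does not depend on the chosen representatives; it is only used for `x ≠ y`.) -/
def line (x y : ℙ K V) : Set (ℙ K V) :=
  {z | ∃ a b : Kˣ, z.rep = (a : K) • x.rep + (b : K) • y.rep} ∪ {x, y}

variable (V) in
/-- The set of lines of the projective space, each one a set of points. -/
def lines : Set (Set (ℙ K V)) :=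
  {l | ∃ x y : ℙ K V, x ≠ y ∧ l = line K x y}

/-- The line through two distinct points, as an element of the set of lines. -/
def lineThrough (x y : ℙ K V) (h : x ≠ y) : lines K V :=
  ⟨line K x y, x, y, h, rfl⟩

variable {K} in
/-- A pair of bijections, `α` on points and `β` on lines, is a collineation if
`ℓ(α x, α y) = β (ℓ(x, y))` for all distinct points `x`, `y`. -/
def IsCollineation (g : Equiv.Perm (ℙ K V) × Equiv.Perm (lines K V)) : Prop :=
  ∀ (x y : ℙ K V) (h : x ≠ y),
    line K (g.1 x) (g.1 y) = (g.2 (lineThrough K x y h) : Set (ℙ K V))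

variable {K} in
theorem IsCollineation.apply_lineThrough {g : Equiv.Perm (ℙ K V) × Equiv.Perm (lines K V)}
    (hg : IsCollineation g) (x y : ℙ K V) (h : x ≠ y) :
    g.2 (lineThrough K x y h) = lineThrough K (g.1 x) (g.1 y) (g.1.injective.ne h) :=
  Subtype.ext (hg x y h).symm

variable (V) in
/-- The collineation group of the projective geometry of `V`, under composition. -/
def collineationGroup : Subgroup (Equiv.Perm (ℙ K V) × Equiv.Perm (lines K V)) where
  carrier := {g | IsCollineation g}
  one_mem' := fun _ _ _ => rfl
  mul_mem' := by
    intro g g' hg hg' x y h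
    have h1 := hg'.apply_lineThrough x y h
    have h2 := hg.apply_lineThrough _ _ (g'.1.injective.ne h)
    change line K (g.1 (g'.1 x)) (g.1 (g'.1 y)) = (g.2 (g'.2 (lineThrough K x y h)) : Set _)
    rw [h1, h2]
    rfl
  inv_mem' := by
    intro g hg x y h
    have h1 := hg.apply_lineThrough (g.1.symm x) (g.1.symm y) (g.1.symm.injective.ne h)
    simp only [Equiv.apply_symm_apply] at h1
    have h2 : g.2.symm (lineThrough K x y h)
        = lineThrough K (g.1.symm x) (g.1.symm y) (g.1.symm.injective.ne h) := by
      rw [← h1, Equiv.symm_apply_apply]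
    exact (congrArg Subtype.val h2).symm

end Geometry

/-! ### Continuous collineations -/

section Topology

variable (K : Type*) [Field K] (V : Type*) [AddCommGroup V] [Module K V] [TopologicalSpace V]

/-- The standard topology of the projective space: the quotient topology from the space of
nonzero vectors. -/
instance standardTopology : TopologicalSpace (ℙ K V) :=
  inferInstanceAs (TopologicalSpace (Quotient (projectivizationSetoid K V)))

/-- The monoid of all collineations `(α, β)` for which `α` is continuous. -/
def continuousCollineationMonoid : Submonoid (collineationGroup K V) where
  carrier := {g | Continuous g.1.1}
  one_mem' := continuous_id
  mul_mem' := fun hg hg' => hg.comp hg'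

/-- The group of all collineations `(α, β)` for which `α` and its inverse are continuous. -/
def continuousCollineationGroup : Subgroup (collineationGroup K V) where
  carrier := {g | Continuous g.1.1 ∧ Continuous g.1.1.symm}
  one_mem' := ⟨continuous_id, continuous_id⟩
  mul_mem' := fun hg hg' => ⟨hg.1.comp hg'.1, hg'.2.comp hg.2⟩
  inv_mem' := fun hg => ⟨hg.2, hg.1⟩

end Topology

/-! ### Projective semilinear groups -/

section Semilinear

/-- The endomorphism of `PGL` given by applying a field automorphism to all matrix entries. -/
def pglMap {ι F : Type*} [Fintype ι] [DecidableEq ι] [Field F] (θ : RingAut F) :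
    Matrix.ProjGenLinGroup ι F →* Matrix.ProjGenLinGroup ι F :=
  Matrix.ProjGenLinGroup.lift
    (Matrix.ProjGenLinGroup.mk.comp (Matrix.GeneralLinearGroup.map (θ : F →+* F))) <| by
    ext u
    have : Matrix.GeneralLinearGroup.map (n := ι) (θ : F →+* F)
        (Matrix.GeneralLinearGroup.scalar ι u)
        = Matrix.GeneralLinearGroup.scalar ι (Units.map (θ : F →* F) u) := by
      ext i j
      by_cases h : i = j <;> simp [Matrix.scalar_apply, h]
    simp [this]

/-- The action of the field automorphisms on `PGL`, entry by entry. -/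
def pglAction (ι F : Type*) [Fintype ι] [DecidableEq ι] [Field F] :
    RingAut F →* MulAut (Matrix.ProjGenLinGroup ι F) where
  toFun θ :=
    { pglMap (ι := ι) θ with
      invFun := pglMap (ι := ι) θ⁻¹
      left_inv := by
        intro g
        induction g using Matrix.ProjGenLinGroup.induction_on with | mk g =>
        refine congrArg Matrix.ProjGenLinGroup.mk (Units.ext (Matrix.ext fun i j => ?_))
        exact θ.symm_apply_apply (g i j)
      right_inv := by
        intro g
        induction g using Matrix.ProjGenLinGroup.induction_on with | mk g =>
        refine congrArg Matrix.ProjGenLinGroup.mk (Units.ext (Matrix.ext fun i j => ?_))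
        exact θ.apply_symm_apply (g i j) }
  map_one' := by
    ext g
    induction g using Matrix.ProjGenLinGroup.induction_on with | mk g => rfl
  map_mul' := by
    intro θ η
    ext g
    induction g using Matrix.ProjGenLinGroup.induction_on with | mk g => rfl

/-- The projective general semilinear group `PΓL(n, F) = PGL(F^(n+1), F) ⋊ Aut(F)`. -/
abbrev PGammaL (n : ℕ) (F : Type*) [Field F] : Type _ :=
  Matrix.ProjGenLinGroup (Fin (n + 1)) F ⋊[pglAction (Fin (n + 1)) F] RingAut F

/-- The group of field automorphisms that are continuous with continuous inverse. -/
def continuousRingAut (F : Type*) [Field F] [TopologicalSpace F] : Subgroup (RingAut F) where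
  carrier := {θ | Continuous θ ∧ Continuous θ.symm}
  one_mem' := ⟨continuous_id, continuous_id⟩
  mul_mem' := fun hg hg' => ⟨hg.1.comp hg'.1, hg'.2.comp hg.2⟩
  inv_mem' := fun hg => ⟨hg.2, hg.1⟩

/-- The projective general continuous semilinear group
`PΓL_τ(n, F) = PGL(F^(n+1), F) ⋊ Aut_τ(F)`. -/
abbrev PGammaLCont (n : ℕ) (F : Type*) [Field F] [TopologicalSpace F] : Type _ :=
  Matrix.ProjGenLinGroup (Fin (n + 1)) F
    ⋊[(pglAction (Fin (n + 1)) F).comp (continuousRingAut F).subtype] continuousRingAut F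

/-- The monoid of all elements of `PΓL(n, F)` whose field automorphism is continuous
(without a condition on the inverse automorphism). -/
def PGammaLContMonoid (n : ℕ) (F : Type*) [Field F] [TopologicalSpace F] :
    Submonoid (PGammaL n F) where
  carrier := {g | Continuous g.right}
  one_mem' := continuous_id
  mul_mem' := fun hg hg' => hg.comp hg'

end Semilinear

end ProjCol

end

open scoped LinearAlgebra.Projectivization

noncomputable section

namespace ProjCol

/-! ### The fundamental theorem of projective geometry, for lattices of subspaces -/

section Lattice

open Submodule LinearMap

variable {K K' V V' : Type*} [Field K] [Field K'] [AddCommGroup V] [AddCommGroup V']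
  [Module K V] [Module K' V']

/-! The point map of a collineation determines its line map, and the point maps that occur are the
permutations preserving and reflecting collinearity (`collineationEquiv`). Such a permutation
carries subspaces to subspaces, hence acts on the lattice of submodules. By
`exists_semilinear_of_orderIso` a lattice isomorphism is induced by a semilinear map: over the
affine chart complementary to a hyperplane it becomes a map of vectors, which is additive because
parallelograms are determined by incidence and which scales by a field isomorphism θ because scalars
can be compared along independent directions. In coordinates this makes the action `[v] ↦ [A θ(v)]`
of PΓL surjective onto these permutations; testing on the points `[e_i]` and `[e_i + t e_j]` makes
it faithful.

For the topological statements, PGL acts by homeomorphisms, so only θ matters, and θ can be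
recovered continuously from its action on the affine line `t ↦ [1 : t]`
(`continuous_autAction_iff`). -/

theorem _root_.Submodule.smul_add_eq_smul_add {H : Submodule K V} {u x y : V} {a b : K}
    (hu : u ∉ H) (hx : x ∈ H) (hy : y ∈ H) (h : a • u + x = b • u + y) : a = b ∧ x = y := by
  have hab : a = b := by
    by_contra hne
    refine hu ((H.smul_mem_iff (sub_ne_zero.2 hne)).1 ?_)
    have : (a - b) • u = y - x := by
      rw [sub_smul, sub_eq_sub_iff_add_eq_add, h, add_comm]
    exact this ▸ H.sub_mem hy hx
  exact ⟨hab, by simpa [hab] using h⟩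

theorem exists_apply_span_singleton_eq (L : Submodule K V ≃o Submodule K' V') (x : V) :
    ∃ y, L (K ∙ x) = K' ∙ y := by
  rcases eq_or_ne x 0 with rfl | hx
  · exact ⟨0, by simp⟩
  · obtain ⟨y, -, hy⟩ := (atom_iff_nonzero_span _).1
      ((L.isAtom_iff _).2 (nonzero_span_atom x hx))
    exact ⟨y, hy⟩

/-- A description in affine coordinates of an isomorphism between lattices of subspaces: `f` is
the induced map on the complement `e + ker φ` of the hyperplane `ker φ`. -/
structure IsAffineChart (L : Submodule K V ≃o Submodule K' V') (φ : V →ₗ[K] K) (e : V)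
    (u : V') (f : V → V') : Prop where
  apply_eq_one : φ e = 1
  notMem : u ∉ L (ker φ)
  map_base : L (K ∙ e) = K' ∙ u
  mem : ∀ w, φ w = 0 → f w ∈ L (ker φ)
  map_add : ∀ w, φ w = 0 → L (K ∙ (e + w)) = K' ∙ (u + f w)

/-- Since `e + w` lies off the hyperplane, a generator of its image has a nonzero `u`-coefficient,
which can be scaled to 1. -/
theorem exists_isAffineChart (L : Submodule K V ≃o Submodule K' V') {φ : V →ₗ[K] K} {e : V}
    (he : φ e = 1) : ∃ u f, IsAffineChart L φ e u f := by
  have notMem : ∀ w, φ w = 0 → ¬ K ∙ (e + w) ≤ ker φ := fun w hw h => by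
    simpa [he, hw] using h (mem_span_singleton_self _)
  obtain ⟨u, hu⟩ := exists_apply_span_singleton_eq L e
  have hu' : u ∉ L (ker φ) := by
    rw [← span_singleton_le_iff_mem, ← hu, L.le_iff_le]
    simpa using notMem 0 (map_zero φ)
  have htop : K' ∙ u ⊔ L (ker φ) = ⊤ := by
    rw [← hu, ← L.map_sup, ← L.map_top]
    congr 1
    refine eq_top_iff.2 fun x _ => mem_sup.2
      ⟨φ x • e, smul_mem _ _ (mem_span_singleton_self e), x - φ x • e, ?_, by abel⟩
    simp [he]
  -- The implication sits inside the existential so that `choose` gives a total function; nothing is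
  -- claimed about `f` off `ker φ`.
  have key : ∀ w, ∃ z, φ w = 0 → z ∈ L (ker φ) ∧ L (K ∙ (e + w)) = K' ∙ (u + z) := by
    intro w
    by_cases hw : φ w = 0
    · obtain ⟨y, hy⟩ := exists_apply_span_singleton_eq L (e + w)
      obtain ⟨y₁, hy₁, z, hz, hyz⟩ := mem_sup.1 (htop ▸ mem_top : y ∈ K' ∙ u ⊔ L (ker φ))
      obtain ⟨a, rfl⟩ := mem_span_singleton.1 hy₁
      have ha : a ≠ 0 := by
        rintro rfl
        refine notMem w hw (L.le_iff_le.1 ?_)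
        rw [hy, span_singleton_le_iff_mem, ← hyz]
        simpa using hz
      refine ⟨a⁻¹ • z, fun _ => ⟨smul_mem _ _ hz, ?_⟩⟩
      rw [hy, ← span_singleton_smul_eq (Ne.isUnit (inv_ne_zero ha)) y, ← hyz, smul_add,
        inv_smul_smul₀ ha]
    · exact ⟨0, fun h => absurd h hw⟩
  choose f hf using key
  exact ⟨u, f, he, hu', hu, fun w hw => (hf w hw).1, fun w hw => (hf w hw).2⟩

namespace IsAffineChart

variable {L : Submodule K V ≃o Submodule K' V'} {φ : V →ₗ[K] K} {e : V} {u : V'} {f : V → V'}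

theorem eq_of_span_eq (h : IsAffineChart L φ e u f) {y z : V'} (hy : y ∈ L (ker φ))
    (hz : z ∈ L (ker φ)) (hyz : K' ∙ (u + y) = K' ∙ (u + z)) : y = z := by
  obtain ⟨c, hc⟩ := mem_span_singleton.1 (hyz ▸ mem_span_singleton_self (u + y))
  obtain ⟨rfl, h2⟩ := smul_add_eq_smul_add h.notMem (smul_mem _ c hz) hy
    (show c • u + c • z = (1 : K') • u + y by rw [one_smul, ← hc, smul_add])
  rw [← h2, one_smul]

theorem map_zero (h : IsAffineChart L φ e u f) : f 0 = 0 := by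
  refine h.eq_of_span_eq (h.mem _ (_root_.map_zero φ)) (zero_mem _) ?_
  rw [← h.map_add 0 (_root_.map_zero φ), add_zero, add_zero, h.map_base]

/-- `K ∙ w` is the point at infinity of the affine line through `e` and `e + w`: it lies in their
span and in the hyperplane. The same description on the image side singles out `f w`. -/
theorem map_span (h : IsAffineChart L φ e u f) {w : V} (hw : φ w = 0) :
    L (K ∙ w) = K' ∙ f w := by
  rcases eq_or_ne w 0 with rfl | hw0
  · simp [h.map_zero]
  have hle : L (K ∙ w) ≤ K' ∙ f w := by
    intro y hy
    have hyH : y ∈ L (ker φ) :=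
      L.monotone ((span_singleton_le_iff_mem _ _).2 (LinearMap.mem_ker.2 hw)) hy
    have hle : K ∙ w ≤ K ∙ e ⊔ K ∙ (e + w) := by
      rw [span_singleton_le_iff_mem, mem_sup]
      exact ⟨-e, neg_mem (mem_span_singleton_self e), _, mem_span_singleton_self _, by abel⟩
    have hy' := L.monotone hle hy
    rw [L.map_sup, h.map_base, h.map_add w hw, mem_sup] at hy'
    obtain ⟨_, h1, _, h2, rfl⟩ := hy'
    obtain ⟨a, rfl⟩ := mem_span_singleton.1 h1
    obtain ⟨b, rfl⟩ := mem_span_singleton.1 h2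
    obtain ⟨-, h4⟩ := smul_add_eq_smul_add (a := a + b) (b := 0) h.notMem
      (smul_mem _ b (h.mem w hw)) hyH (by module)
    exact mem_span_singleton.2 ⟨b, h4⟩
  have hatom := (L.isAtom_iff _).2 (nonzero_span_atom w hw0)
  have hf : f w ≠ 0 := by
    intro h0
    rw [h0, span_zero_singleton, le_bot_iff] at hle
    exact hatom.1 hle
  exact ((nonzero_span_atom _ hf).le_iff.1 hle).resolve_left hatom.1

theorem mem_span_iff (h : IsAffineChart L φ e u f) {v w : V} (hv : φ v = 0) (hw : φ w = 0) :
    f v ∈ K' ∙ f w ↔ v ∈ K ∙ w := by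
  rw [← span_singleton_le_iff_mem, ← h.map_span hv, ← h.map_span hw, L.le_iff_le,
    span_singleton_le_iff_mem]

theorem eq_zero_iff (h : IsAffineChart L φ e u f) {v : V} (hv : φ v = 0) :
    f v = 0 ↔ v = 0 := by
  simpa [h.map_zero] using h.mem_span_iff hv (_root_.map_zero φ)

/-- The point `e + (w + v)` lies on the affine line through `e + w` with direction `v`. -/
theorem exists_map_add (h : IsAffineChart L φ e u f) {v w : V} (hv : φ v = 0) (hw : φ w = 0) :
    ∃ c : K', f (w + v) = f w + c • f v := by
  have hwv : φ (w + v) = 0 := by simp [hv, hw]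
  have hle : K ∙ (e + (w + v)) ≤ K ∙ (e + w) ⊔ K ∙ v := by
    rw [span_singleton_le_iff_mem, mem_sup]
    exact ⟨_, mem_span_singleton_self _, _, mem_span_singleton_self _, by abel⟩
  have hle' := L.monotone hle
  rw [L.map_sup, h.map_add _ hwv, h.map_add w hw, h.map_span hv, span_singleton_le_iff_mem,
    mem_sup] at hle'
  obtain ⟨_, h1, _, h2, h3⟩ := hle'
  obtain ⟨a, rfl⟩ := mem_span_singleton.1 h1
  obtain ⟨b, rfl⟩ := mem_span_singleton.1 h2
  obtain ⟨rfl, h4⟩ := smul_add_eq_smul_add (a := a) (b := 1) h.notMem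
    (add_mem (smul_mem _ a (h.mem w hw)) (smul_mem _ b (h.mem v hv))) (h.mem _ hwv)
    (by rw [one_smul, ← h3]; module)
  exact ⟨b, by rw [← h4, one_smul]⟩

/-- Parallelogram argument: the fourth vertex lies on two lines, and the independence of `f v` and
`f w` forces both unknown coefficients to be 1. -/
theorem map_add_of_notMem (h : IsAffineChart L φ e u f) {v w : V} (hv : φ v = 0) (hw : φ w = 0)
    (hvw : v ∉ K ∙ w) : f (w + v) = f w + f v := by
  obtain ⟨c, hc⟩ := h.exists_map_add hv hw
  obtain ⟨d, hd⟩ := h.exists_map_add hw hv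
  have h1 : (1 - c) • f v = (1 - d) • f w := by
    have := hc.symm.trans ((congrArg f (add_comm w v)).trans hd)
    rw [sub_smul, sub_smul, one_smul, one_smul, sub_eq_sub_iff_add_eq_add, this.symm, add_comm]
  have hc1 : 1 - c = 0 := by
    by_contra hne
    refine hvw ((h.mem_span_iff hv hw).1 (((K' ∙ f w).smul_mem_iff hne).1 ?_))
    exact h1 ▸ smul_mem _ _ (mem_span_singleton_self _)
  rw [hc, ← sub_eq_zero.1 hc1, one_smul]

-- The hyperplane `ker φ` has dimension at least two, so an auxiliary direction is always available.
variable (hdim : ∀ w, ∃ v, φ v = 0 ∧ v ∉ K ∙ w)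
include hdim

theorem map_add_add (h : IsAffineChart L φ e u f) {v w : V} (hv : φ v = 0) (hw : φ w = 0) :
    f (w + v) = f w + f v := by
  by_cases hvw : v ∈ K ∙ w
  · rcases eq_or_ne w 0 with rfl | hw0
    · simp [h.map_zero]
    -- For dependent vectors, expand `w + v + x` in two ways, with `x` off their common line, and
    -- cancel `f x`.
    obtain ⟨x, hx, hxw⟩ := hdim w
    have hle : K ∙ v ≤ K ∙ w := (span_singleton_le_iff_mem _ _).2 hvw
    have hle' : K ∙ (w + v) ≤ K ∙ w :=
      (span_singleton_le_iff_mem _ _).2 (add_mem (mem_span_singleton_self w) hvw)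
    have h1 : f (w + v + x) = f (w + v) + f x :=
      h.map_add_of_notMem hx (by simp [hv, hw]) fun hx' => hxw (hle' hx')
    have h2 : f (v + x) = f v + f x := h.map_add_of_notMem hx hv fun hx' => hxw (hle hx')
    have h3 : f (w + (v + x)) = f w + f (v + x) :=
      h.map_add_of_notMem (by simp [hv, hx]) hw fun hx' => hxw ((Submodule.add_mem_iff_right _ hvw).1 hx')
    rw [← add_assoc, h1, h2, ← add_assoc] at h3
    exact add_right_cancel h3
  · exact h.map_add_of_notMem hv hw hvw

/-- Each vector has its own scalar for `t`. For `w` independent of `w₀`, expanding `f (t • (w₀ +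
w))` shows that both scalars equal that of `w₀ + w`; multiples of `w₀` are handled by adding an
independent `x`. -/
theorem exists_ringHom (h : IsAffineChart L φ e u f) :
    ∃ θ : K →+* K', ∀ t w, φ w = 0 → f (t • w) = θ t • f w := by
  obtain ⟨w₀, hw₀, hne⟩ := hdim 0
  have hne : w₀ ≠ 0 := by simpa using hne
  have hf₀ : f w₀ ≠ 0 := (h.eq_zero_iff hw₀).not.2 hne
  have hφ : ∀ (t : K) (w : V), φ w = 0 → φ (t • w) = 0 := fun t w hw => by simp [hw]
  have hex : ∀ (t : K) (w : V), φ w = 0 → ∃ c : K', f (t • w) = c • f w := by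
    intro t w hw
    obtain ⟨c, hc⟩ := mem_span_singleton.1 ((h.mem_span_iff (hφ t w hw) hw).2
      (smul_mem _ t (mem_span_singleton_self w)))
    exact ⟨c, hc.symm⟩
  choose θ hθ using fun t => hex t w₀ hw₀
  have hout : ∀ t w, φ w = 0 → w ∉ K ∙ w₀ → f (t • w) = θ t • f w := by
    intro t w hw hww
    obtain ⟨c, hc⟩ := hex t w hw
    obtain ⟨d, hd⟩ := hex t (w₀ + w) (by simp [hw, hw₀])
    rw [smul_add, h.map_add_add hdim (hφ t w hw) (hφ t w₀ hw₀), h.map_add_add hdim hw hw₀, hθ,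
      hc] at hd
    have h1 : (θ t - d) • f w₀ = (d - c) • f w := by
      rw [sub_smul, sub_smul, sub_eq_sub_iff_add_eq_add, hd]
      module
    have h2 : d - c = 0 := by
      by_contra hne
      refine hww ((h.mem_span_iff hw hw₀).1 (((K' ∙ f w₀).smul_mem_iff hne).1 ?_))
      exact h1 ▸ smul_mem _ _ (mem_span_singleton_self _)
    rw [h2, zero_smul, smul_eq_zero_iff_left hf₀] at h1
    rw [hc, ← sub_eq_zero.1 h2, sub_eq_zero.1 h1]
  have hall : ∀ t w, φ w = 0 → f (t • w) = θ t • f w := by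
    intro t w hw
    by_cases hww : w ∈ K ∙ w₀
    · obtain ⟨x, hx, hxw⟩ := hdim w₀
      have h1 := hout t (w + x) (by simp [hw, hx]) fun h' => hxw ((Submodule.add_mem_iff_right _ hww).1 h')
      rw [smul_add, h.map_add_add hdim (hφ t x hx) (hφ t w hw), h.map_add_add hdim hx hw,
        hout t x hx hxw, smul_add] at h1
      exact add_right_cancel h1
    · exact hout t w hw hww
  have hinj : ∀ {a b : K'}, a • f w₀ = b • f w₀ → a = b := fun hab => smul_left_injective _ hf₀ hab
  refine ⟨{ toFun := θ, map_one' := ?_, map_mul' := ?_, map_zero' := ?_, map_add' := ?_ }, hall⟩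
  · exact hinj (by rw [← hθ, one_smul, one_smul])
  · intro s t
    exact hinj (by rw [← hθ, mul_smul, hall s _ (hφ t w₀ hw₀), hθ t, mul_smul])
  · exact hinj (by rw [← hθ, zero_smul, zero_smul, h.map_zero])
  · intro s t
    exact hinj (by rw [← hθ, add_smul, h.map_add_add hdim (hφ t _ hw₀) (hφ s _ hw₀), hθ, hθ,
      add_smul])

omit hdim in
-- The preimage of the point `u + y` is off the hyperplane, so its generator can be scaled to the
-- form `e + w`. This gives the surjectivity of θ.
theorem exists_preimage (h : IsAffineChart L φ e u f) {y : V'} (hy : y ∈ L (ker φ)) :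
    ∃ w, φ w = 0 ∧ f w = y := by
  obtain ⟨x, hx⟩ := exists_apply_span_singleton_eq L.symm (u + y)
  rw [L.symm_apply_eq] at hx
  have hφx : φ x ≠ 0 := by
    intro h0
    have hle : K' ∙ (u + y) ≤ L (ker φ) := by
      rw [hx, L.le_iff_le, span_singleton_le_iff_mem]
      exact h0
    exact h.notMem ((Submodule.add_mem_iff_left _ hy).1 (hle (mem_span_singleton_self _)))
  have hw : φ ((φ x)⁻¹ • x - e) = 0 := by simp [h.apply_eq_one, hφx]
  refine ⟨_, hw, h.eq_of_span_eq (h.mem _ hw) hy ?_⟩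
  rw [← h.map_add _ hw, add_sub_cancel, span_singleton_smul_eq (Ne.isUnit (inv_ne_zero hφx)), hx]

end IsAffineChart

/-- **Fundamental theorem of projective geometry**: an isomorphism between the lattices of
subspaces of two vector spaces of dimension at least three is induced by a semilinear map. -/
theorem exists_semilinear_of_orderIso (L : Submodule K V ≃o Submodule K' V')
    (hdim : ∀ v w : V, span K {v, w} ≠ ⊤) :
    ∃ (θ : K ≃+* K') (g : V →ₛₗ[(θ : K →+* K')] V'), ∀ x, L (K ∙ x) = K' ∙ g x := by
  have : Nontrivial V := by
    by_contra hV
    rw [not_nontrivial_iff_subsingleton] at hV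
    exact hdim 0 0 (Subsingleton.elim _ _)
  obtain ⟨e₀, he₀⟩ := exists_ne (0 : V)
  obtain ⟨φ₀, hφ₀⟩ := not_forall.1 ((Module.forall_dual_apply_eq_zero_iff K e₀).not.2 he₀)
  obtain ⟨φ, e, he⟩ : ∃ (φ : V →ₗ[K] K) (e : V), φ e = 1 :=
    ⟨φ₀, (φ₀ e₀)⁻¹ • e₀, by simp [hφ₀]⟩
  have hdim' : ∀ w, ∃ v, φ v = 0 ∧ v ∉ K ∙ w := by
    intro w
    by_contra! hall
    refine hdim e w (eq_top_iff.2 fun x _ => ?_)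
    obtain ⟨c, hc⟩ := mem_span_singleton.1 (hall (x - φ x • e) (by simp [he]))
    exact mem_span_pair.2 ⟨φ x, c, by rw [hc]; abel⟩
  obtain ⟨u, f, h⟩ := exists_isAffineChart L he
  obtain ⟨θ, hθ⟩ := h.exists_ringHom hdim'
  have hsurj : Function.Surjective θ := by
    intro c
    obtain ⟨w₀, hw₀, hne⟩ := hdim' 0
    have hf₀ : f w₀ ≠ 0 := (h.eq_zero_iff hw₀).not.2 (by simpa using hne)
    obtain ⟨w, hw, hfw⟩ := h.exists_preimage (smul_mem _ c (h.mem w₀ hw₀))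
    obtain ⟨t, rfl⟩ := mem_span_singleton.1 ((h.mem_span_iff hw hw₀).1
      (hfw ▸ smul_mem _ c (mem_span_singleton_self _)))
    exact ⟨t, smul_left_injective _ hf₀ ((hθ t w₀ hw₀).symm.trans hfw)⟩
  have hπ : ∀ x, φ (x - φ x • e) = 0 := fun x => by simp [he]
  refine ⟨RingEquiv.ofBijective θ ⟨θ.injective, hsurj⟩,
    -- Glue along `V = K e ⊕ ker φ`: send `e` to `u` and use `f` on the hyperplane.
    { toFun := fun x => θ (φ x) • u + f (x - φ x • e), map_add' := ?_, map_smul' := ?_ }, ?_⟩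
  · intro x y
    have : x + y - φ (x + y) • e = (x - φ x • e) + (y - φ y • e) := by
      rw [_root_.map_add]; module
    rw [this, h.map_add_add hdim' (hπ y) (hπ x), _root_.map_add, _root_.map_add]
    module
  · intro c x
    have : c • x - φ (c • x) • e = c • (x - φ x • e) := by
      rw [map_smul, smul_eq_mul]; module
    rw [this, hθ _ _ (hπ x), map_smul, smul_eq_mul, map_mul, mul_smul, ← smul_add]
    rfl
  · intro x
    change L (K ∙ x) = K' ∙ (θ (φ x) • u + f (x - φ x • e))
    rcases eq_or_ne (φ x) 0 with h0 | h0
    · simp [h0, h.map_span]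
    have hx : (φ x)⁻¹ • x = e + (φ x)⁻¹ • (x - φ x • e) := by
      rw [smul_sub, inv_smul_smul₀ h0]; abel
    rw [← span_singleton_smul_eq (Ne.isUnit (inv_ne_zero h0)) x, hx,
      h.map_add _ (by simp [he]), hθ _ _ (hπ x), map_inv₀,
      ← span_singleton_smul_eq (Ne.isUnit ((map_ne_zero θ).2 h0)), smul_add,
      smul_inv_smul₀ ((map_ne_zero θ).2 h0)]

end Lattice

/-! ### Collineations as permutations of points -/

section Points

open Submodule

variable {K V : Type*} [Field K] [AddCommGroup V] [Module K V]

theorem _root_.Projectivization.eq_iff_submodule_le {x y : ℙ K V} :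
    x = y ↔ x.submodule ≤ y.submodule := by
  refine ⟨fun h => h ▸ le_rfl, fun h => ?_⟩
  induction x with | h v hv =>
  induction y with | h w hw =>
  rw [Projectivization.submodule_mk, Projectivization.submodule_mk,
    span_singleton_le_iff_mem, mem_span_singleton] at h
  exact (Projectivization.mk_eq_mk_iff' K v w hv hw).2 h

/-- Frees lines from the choice of representatives and covers `x = y`. The two added endpoints
account for a vanishing coefficient. -/
theorem mem_line_iff {x y z : ℙ K V} :
    z ∈ line K x y ↔ z.submodule ≤ x.submodule ⊔ y.submodule := by
  constructor
  · rintro (⟨a, b, h⟩ | rfl | rfl)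
    · rw [z.submodule_eq, span_singleton_le_iff_mem, h, x.submodule_eq, y.submodule_eq]
      exact add_mem (mem_sup_left (smul_mem _ _ (mem_span_singleton_self _)))
        (mem_sup_right (smul_mem _ _ (mem_span_singleton_self _)))
    · exact le_sup_left
    · exact le_sup_right
  · intro h
    have hz : z.rep ∈ x.submodule ⊔ y.submodule :=
      h (by rw [z.submodule_eq]; exact mem_span_singleton_self _)
    rw [x.submodule_eq, y.submodule_eq, mem_sup] at hz
    obtain ⟨_, h1, _, h2, h3⟩ := hz
    obtain ⟨a, rfl⟩ := mem_span_singleton.1 h1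
    obtain ⟨b, rfl⟩ := mem_span_singleton.1 h2
    have heq : ∀ w : ℙ K V, z.rep ∈ K ∙ w.rep → z = w := fun w hw => by
      rw [Projectivization.eq_iff_submodule_le, z.submodule_eq, w.submodule_eq]
      exact (span_singleton_le_iff_mem _ _).2 hw
    rcases eq_or_ne a 0 with rfl | ha
    · exact Or.inr (Or.inr (heq y (by rw [← h3]; simpa using h2)))
    rcases eq_or_ne b 0 with rfl | hb
    · exact Or.inr (Or.inl (heq x (by rw [← h3]; simpa using h1)))
    exact Or.inl ⟨Units.mk0 a ha, Units.mk0 b hb, h3.symm⟩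

theorem left_mem_line (x y : ℙ K V) : x ∈ line K x y := mem_line_iff.2 le_sup_left

theorem right_mem_line (x y : ℙ K V) : y ∈ line K x y := mem_line_iff.2 le_sup_right

theorem line_self (x : ℙ K V) : line K x x = {x} := by
  ext z
  rw [mem_line_iff, sup_idem, ← Projectivization.eq_iff_submodule_le, Set.mem_singleton_iff]

theorem line_eq_line_of_mem {x y z : ℙ K V} (hxz : x ≠ z) (hz : z ∈ line K x y) :
    line K x z = line K x y := by
  have hle := mem_line_iff.1 hz
  have hsup : x.submodule ⊔ z.submodule = x.submodule ⊔ y.submodule := by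
    refine le_antisymm (sup_le le_sup_left hle) (sup_le le_sup_left ?_)
    induction x with | h v hv =>
    induction y with | h w hw =>
    induction z with | h t ht =>
    simp only [Projectivization.submodule_mk, span_singleton_le_iff_mem] at hle ⊢
    obtain ⟨_, h1, _, h2, rfl⟩ := mem_sup.1 hle
    obtain ⟨a, rfl⟩ := mem_span_singleton.1 h1
    obtain ⟨b, rfl⟩ := mem_span_singleton.1 h2
    rcases eq_or_ne b 0 with rfl | hb
    · refine absurd ((Projectivization.mk_eq_mk_iff' K _ _ ht hv).2 ⟨a, by simp⟩).symm hxz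
    · refine mem_sup.2 ⟨-(b⁻¹ • a • v), neg_mem (smul_mem _ _ h1), b⁻¹ • (a • v + b • w),
        smul_mem _ _ (mem_span_singleton_self _), ?_⟩
      rw [smul_add, inv_smul_smul₀ hb]
      abel
  ext t
  rw [mem_line_iff, mem_line_iff, hsup]

variable (K V) in
/-- The group of permutations of the points that preserve collinearity. -/
def linePreserving : Subgroup (Equiv.Perm (ℙ K V)) where
  carrier := {α | ∀ x y z, α z ∈ line K (α x) (α y) ↔ z ∈ line K x y}
  one_mem' := fun _ _ _ => Iff.rfl
  mul_mem' := fun hα hβ x y z => (hα _ _ _).trans (hβ x y z)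
  inv_mem' := fun {α} hα x y z => by simpa using (hα (α⁻¹ x) (α⁻¹ y) (α⁻¹ z)).symm

theorem image_line {α : Equiv.Perm (ℙ K V)} (hα : α ∈ linePreserving K V) (x y : ℙ K V) :
    α '' line K x y = line K (α x) (α y) := by
  ext z
  rw [Equiv.image_eq_preimage_symm, Set.mem_preimage, ← hα, Equiv.apply_symm_apply]

theorem image_mem_lines {α : Equiv.Perm (ℙ K V)} (hα : α ∈ linePreserving K V)
    {l : Set (ℙ K V)} (hl : l ∈ lines K V) : α '' l ∈ lines K V := by
  obtain ⟨x, y, hxy, rfl⟩ := hl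
  exact ⟨α x, α y, α.injective.ne hxy, image_line hα x y⟩

/-- The permutation of the lines induced by a line preserving permutation of the points. -/
def linePerm (α : Equiv.Perm (ℙ K V)) (hα : α ∈ linePreserving K V) :
    Equiv.Perm (lines K V) where
  toFun l := ⟨α '' l, image_mem_lines hα l.2⟩
  invFun l := ⟨(α⁻¹ : Equiv.Perm (ℙ K V)) '' l, image_mem_lines (inv_mem hα) l.2⟩
  left_inv l := Subtype.ext (α.symm_image_image l)
  right_inv l := Subtype.ext (α.image_symm_image l)

/-- For `z ≠ x` the pairs `x, z` and `x, y` span the same line, so β gives them the same image.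
Coinciding points are treated apart, since the collineation condition says nothing about them. -/
theorem IsCollineation.apply_mem_line {g : Equiv.Perm (ℙ K V) × Equiv.Perm (lines K V)}
    (hg : IsCollineation g) {x y z : ℙ K V} (hz : z ∈ line K x y) :
    g.1 z ∈ line K (g.1 x) (g.1 y) := by
  rcases eq_or_ne x z with rfl | hxz
  · exact left_mem_line _ _
  rcases eq_or_ne x y with rfl | hxy
  · rw [line_self] at hz
    exact absurd hz.symm hxz
  have h : lineThrough K x z hxz = lineThrough K x y hxy :=
    Subtype.ext (line_eq_line_of_mem hxz hz)
  rw [hg x y hxy, ← h, ← hg x z hxz]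
  exact right_mem_line _ _

theorem fst_mem_linePreserving (g : collineationGroup K V) : g.1.1 ∈ linePreserving K V := by
  intro x y z
  refine ⟨fun h => ?_, fun h => g.2.apply_mem_line h⟩
  have h' := (g⁻¹).2.apply_mem_line h
  change g.1.1.symm _ ∈ line K (g.1.1.symm _) (g.1.1.symm _) at h'
  simpa using h'

variable (K V) in
/-- A collineation is determined by its action on points, and every permutation of the points
that preserves collinearity is part of a collineation. -/
def collineationEquiv : collineationGroup K V ≃* linePreserving K V :=
  MulEquiv.ofBijective
    (((MonoidHom.fst _ _).comp (collineationGroup K V).subtype).codRestrict _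
      fst_mem_linePreserving)
    ⟨by
      intro g g' h
      have h1 : g.1.1 = g'.1.1 := congrArg Subtype.val h
      refine Subtype.ext (Prod.ext h1 (Equiv.ext fun l => Subtype.ext ?_))
      obtain ⟨_, x, y, hxy, rfl⟩ := l
      exact (g.2 x y hxy).symm.trans (h1 ▸ g'.2 x y hxy),
    fun α => ⟨⟨(α.1, linePerm α.1 α.2), fun x y _ => (image_line α.2 x y).symm⟩, rfl⟩⟩

theorem mem_linePreserving_of_semilinear {σ : K →+* K} [RingHomSurjective σ] {f : V →ₛₗ[σ] V}
    (hf : Function.Injective f) {α : Equiv.Perm (ℙ K V)}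
    (hα : ∀ x, (α x).submodule = x.submodule.map f) : α ∈ linePreserving K V := by
  intro x y z
  rw [mem_line_iff, mem_line_iff, hα, hα, hα, ← Submodule.map_sup,
    Submodule.map_le_map_iff_of_injective hf]

end Points

/-! ### The action of collineations on subspaces -/

section Subspaces

variable {K V : Type*} [Field K] [AddCommGroup V] [Module K V]

theorem mem_subspace_of_mem_line {S : Projectivization.Subspace K V} {x y z : ℙ K V}
    (hx : x ∈ S) (hy : y ∈ S) (hz : z ∈ line K x y) : z ∈ S := by
  rw [← Projectivization.Subspace.submodule.symm_apply_apply S] at hx hy ⊢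
  rw [Submodule.mem_projectivization_iff_submodule_le] at hx hy ⊢
  exact (mem_line_iff.1 hz).trans (sup_le hx hy)

/-- The preimage of a projective subspace under a line preserving permutation. -/
def comapSubspace {α : Equiv.Perm (ℙ K V)} (hα : α ∈ linePreserving K V)
    (S : Projectivization.Subspace K V) : Projectivization.Subspace K V where
  carrier := α ⁻¹' S
  mem_add' v w hv hw hvw h1 h2 := by
    refine mem_subspace_of_mem_line h1 h2 ((hα _ _ _).2 (mem_line_iff.2 ?_))
    simp only [Projectivization.submodule_mk, Submodule.span_singleton_le_iff_mem]
    exact add_mem (Submodule.mem_sup_left (Submodule.mem_span_singleton_self v))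
      (Submodule.mem_sup_right (Submodule.mem_span_singleton_self w))

theorem mem_comapSubspace {α : Equiv.Perm (ℙ K V)} (hα : α ∈ linePreserving K V)
    (S : Projectivization.Subspace K V) (x : ℙ K V) : x ∈ comapSubspace hα S ↔ α x ∈ S :=
  Iff.rfl

/-- The automorphism of the lattice of projective subspaces induced by a line preserving
permutation of the points. -/
def subspaceOrderIso {α : Equiv.Perm (ℙ K V)} (hα : α ∈ linePreserving K V) :
    Projectivization.Subspace K V ≃o Projectivization.Subspace K V where
  toFun := comapSubspace (inv_mem hα)
  invFun := comapSubspace hα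
  left_inv S := SetLike.ext fun x => by simp [mem_comapSubspace]
  right_inv S := SetLike.ext fun x => by simp [mem_comapSubspace]
  map_rel_iff' {S T} := by
    refine ⟨fun h x hx => ?_, fun h x hx => h hx⟩
    have hx' : α x ∈ comapSubspace (inv_mem hα) S := by simpa [mem_comapSubspace] using hx
    simpa [mem_comapSubspace] using h hx'

/-- The automorphism of the lattice of submodules induced by a line preserving permutation of the
points. -/
def submoduleOrderIso {α : Equiv.Perm (ℙ K V)} (hα : α ∈ linePreserving K V) :
    Submodule K V ≃o Submodule K V :=
  (Projectivization.Subspace.submodule.symm.trans (subspaceOrderIso hα)).trans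
    Projectivization.Subspace.submodule

theorem submoduleOrderIso_submodule {α : Equiv.Perm (ℙ K V)} (hα : α ∈ linePreserving K V)
    (x : ℙ K V) : submoduleOrderIso hα x.submodule = (α x).submodule := by
  ext v
  rcases eq_or_ne v 0 with rfl | hv
  · simp
  rw [submoduleOrderIso, OrderIso.trans_apply, Projectivization.Subspace.mem_submodule_iff _ hv,
    OrderIso.trans_apply]
  change α⁻¹ (Projectivization.mk K v hv) ∈ x.submodule.projectivization ↔ _
  rw [Submodule.mem_projectivization_iff_submodule_le, ← Projectivization.eq_iff_submodule_le,
    Equiv.Perm.inv_eq_iff_eq, Projectivization.eq_iff_submodule_le,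
    Projectivization.submodule_mk, Submodule.span_singleton_le_iff_mem]

/-- **Fundamental theorem of projective geometry** for permutations of the points. -/
theorem exists_semilinear_of_mem_linePreserving (hdim : ∀ v w : V, Submodule.span K {v, w} ≠ ⊤)
    {α : Equiv.Perm (ℙ K V)} (hα : α ∈ linePreserving K V) :
    ∃ (θ : K ≃+* K) (g : V →ₛₗ[(θ : K →+* K)] V) (hg : ∀ v, v ≠ 0 → g v ≠ 0),
      ∀ v hv, α (Projectivization.mk K v hv) = Projectivization.mk K (g v) (hg v hv) := by
  obtain ⟨θ, g, h⟩ := exists_semilinear_of_orderIso (submoduleOrderIso hα) hdim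
  have hg : ∀ v, v ≠ 0 → g v ≠ 0 := fun v hv h0 => by
    have := h v
    rw [h0, Submodule.span_zero_singleton, map_eq_bot_iff] at this
    exact hv (Submodule.span_singleton_eq_bot.1 this)
  refine ⟨θ, g, hg, fun v hv => Projectivization.submodule_injective ?_⟩
  rw [← submoduleOrderIso_submodule hα, Projectivization.submodule_mk, h,
    Projectivization.submodule_mk]

end Subspaces

/-! ### The action of the projective semilinear group on points -/

section SemilinearAction

open Projectivization

variable {ι F : Type*} [Field F]

/-- A field automorphism applied to all coordinates of a vector. -/
def coordMap (ι : Type*) (θ : RingAut F) :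
    (ι → F) →ₛₗ[((θ : F ≃+* F) : F →+* F)] (ι → F) where
  toFun v i := θ (v i)
  map_add' v w := funext fun i => map_add θ (v i) (w i)
  map_smul' c v := funext fun i => map_mul θ c (v i)

theorem coordMap_injective (θ : RingAut F) : Function.Injective (coordMap ι θ) :=
  fun _ _ h => funext fun i => θ.injective (congrFun h i)

/-- The action of the field automorphisms on the points of the standard projective space. -/
def autAction (ι F : Type*) [Field F] : RingAut F →* Equiv.Perm (ℙ F (ι → F)) where
  toFun θ :=
    { toFun := map (coordMap ι θ) (coordMap_injective θ)
      invFun := map (coordMap ι θ⁻¹) (coordMap_injective θ⁻¹)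
      left_inv := Projectivization.ind fun v hv => by
        simp only [map_mk]
        congr 1
        exact funext fun i => θ.symm_apply_apply (v i)
      right_inv := Projectivization.ind fun v hv => by
        simp only [map_mk]
        congr 1
        exact funext fun i => θ.apply_symm_apply (v i) }
  map_one' := Equiv.ext <| Projectivization.ind fun _ _ => rfl
  map_mul' _ _ := Equiv.ext <| Projectivization.ind fun _ _ => rfl

theorem autAction_mk (θ : RingAut F) (v : ι → F) (hv : v ≠ 0) :
    autAction ι F θ (mk F v hv) =
      mk F (coordMap ι θ v) (map_zero (coordMap ι θ) ▸ (coordMap_injective θ).ne hv) := rfl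

variable [Fintype ι] [DecidableEq ι]

/-- The semilinear action of `PΓL` on the points of the standard projective space. -/
def pointAction (ι F : Type*) [Fintype ι] [DecidableEq ι] [Field F] :
    Matrix.ProjGenLinGroup ι F ⋊[pglAction ι F] RingAut F →* Equiv.Perm (ℙ F (ι → F)) :=
  SemidirectProduct.lift (MulAction.toPermHom (Matrix.ProjGenLinGroup ι F) (ℙ F (ι → F)))
    (autAction ι F) fun θ => by
      refine MonoidHom.ext fun g => ?_
      induction g using Matrix.ProjGenLinGroup.induction_on with | mk g =>
      change _ = autAction ι F θ * _ * (autAction ι F θ)⁻¹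
      -- Compatibility with the semidirect product says that conjugating `A` by the coordinatewise θ
      -- applies θ to the entries of `A`.
      rw [eq_mul_inv_iff_mul_eq]
      refine Equiv.ext <| Projectivization.ind fun v hv => ?_
      change (Matrix.ProjGenLinGroup.mk (Matrix.GeneralLinearGroup.map (θ : F →+* F) g) •
        autAction ι F θ (mk F v hv) : ℙ F (ι → F)) =
        autAction ι F θ ((Matrix.ProjGenLinGroup.mk g) • (mk F v hv))
      rw [PGL.mk_smul_mk, autAction_mk, autAction_mk, PGL.mk_smul_mk]
      congr 1
      exact funext fun i => (RingHom.map_mulVec (θ : F →+* F) g.1 v i).symm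

theorem pointAction_mk (A : Matrix.GeneralLinearGroup ι F) (θ : RingAut F) (v : ι → F)
    (hv : v ≠ 0) (h : A.1.mulVec (coordMap ι θ v) ≠ 0) :
    pointAction ι F ⟨Matrix.ProjGenLinGroup.mk A, θ⟩ (mk F v hv) =
      mk F (A.1.mulVec (coordMap ι θ v)) h := rfl

theorem mulVec_coordMap_injective (A : Matrix.GeneralLinearGroup ι F) (θ : RingAut F) :
    Function.Injective (A.1.mulVecLin.comp (coordMap ι θ)) :=
  (Matrix.mulVec_injective_iff_isUnit.2 A.isUnit).comp (coordMap_injective θ)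

theorem mulVec_coordMap_ne_zero (A : Matrix.GeneralLinearGroup ι F) (θ : RingAut F) {v : ι → F}
    (hv : v ≠ 0) : A.1.mulVec (coordMap ι θ v) ≠ 0 := by
  have h := (mulVec_coordMap_injective A θ).ne hv
  rwa [map_zero] at h

theorem pointAction_mem_linePreserving
    (g : Matrix.ProjGenLinGroup ι F ⋊[pglAction ι F] RingAut F) :
    pointAction ι F g ∈ linePreserving F (ι → F) := by
  obtain ⟨g, θ⟩ := g
  induction g using Matrix.ProjGenLinGroup.induction_on with | mk A =>
  have : RingHomSurjective ((θ : F ≃+* F) : F →+* F) := ⟨θ.surjective⟩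
  refine mem_linePreserving_of_semilinear (mulVec_coordMap_injective A θ) <|
    Projectivization.ind fun v hv => ?_
  rw [pointAction_mk A θ v hv (mulVec_coordMap_ne_zero A θ hv), submodule_mk, submodule_mk,
    Submodule.map_span, Set.image_singleton]
  rfl

/-- A matrix for which every nonzero vector is an eigenvector is scalar, hence central. -/
theorem mk_eq_one_of_smul_eq (A : Matrix.GeneralLinearGroup ι F)
    (h : ∀ v : ι → F, v ≠ 0 → ∃ a : F, a • v = A.1.mulVec v) :
    Matrix.ProjGenLinGroup.mk A = 1 := by
  obtain ⟨a, ha⟩ := A.1.mulVecLin.exists_eq_smul_id_of_forall_notLinearIndependent fun v => by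
    rcases eq_or_ne v 0 with rfl | hv
    · simp [linearIndependent_fin2]
    · rw [LinearIndependent.pair_iff' hv]
      push Not
      exact h v hv
  rw [Matrix.ProjGenLinGroup.mk_eq_one, Subgroup.mem_center_iff]
  intro B
  have hA : A.1 = a • 1 := by
    refine Matrix.ext_of_mulVec_single fun i => ?_
    rw [← Matrix.mulVecLin_apply, ha, Matrix.smul_mulVec, Matrix.one_mulVec]
    rfl
  refine Units.ext ?_
  rw [Units.val_mul, Units.val_mul, hA]
  simp

theorem pointAction_injective [Nontrivial ι] : Function.Injective (pointAction ι F) := by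
  rw [injective_iff_map_eq_one]
  rintro ⟨g, θ⟩ hg
  induction g using Matrix.ProjGenLinGroup.induction_on with | mk A =>
  have key : ∀ v : ι → F, v ≠ 0 → ∃ a : F, a • v = A.1.mulVec (coordMap ι θ v) := by
    intro v hv
    have h := congrArg (fun α : Equiv.Perm (ℙ F (ι → F)) => α (mk F v hv)) hg
    simp only [pointAction_mk A θ v hv (mulVec_coordMap_ne_zero A θ hv),
      Equiv.Perm.one_apply] at h
    exact (mk_eq_mk_iff' F _ _ _ _).1 h
  obtain ⟨i, j, hij⟩ := exists_pair_ne ι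
  have hcoord : ∀ (k : ι) (t : F), coordMap ι θ (Pi.single k t) = Pi.single k (θ t) := by
    intro k t
    refine funext fun l => ?_
    change θ ((Pi.single k t : ι → F) l) = _
    rcases eq_or_ne l k with rfl | h <;> simp [*]
  have hsingle : ∀ k : ι, ∃ a : F, ∀ t, A.1.mulVec (Pi.single k t) = Pi.single k (t * a) := by
    intro k
    obtain ⟨a, ha⟩ := key (Pi.single k 1) (by simp)
    rw [hcoord, map_one] at ha
    refine ⟨a, fun t => ?_⟩
    have : (Pi.single k t : ι → F) = t • Pi.single k 1 := by simp [← Pi.single_smul]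
    rw [this, Matrix.mulVec_smul, ← ha, smul_smul, ← Pi.single_smul, smul_eq_mul, mul_one]
  obtain ⟨a, ha⟩ := hsingle i
  obtain ⟨b, hb⟩ := hsingle j
  -- Fixing `[e_i + t e_j]` gives `a t = θ(t) b`; the case `t = 1` yields `a = b`, and then θ is the
  -- identity.
  have hpair : ∀ t, ∃ c : F, c = a ∧ c * t = θ t * b := by
    intro t
    obtain ⟨c, hc⟩ := key (Pi.single i 1 + Pi.single j t) fun h => by
      simpa [hij] using congrFun h i
    rw [map_add, hcoord, hcoord, map_one, Matrix.mulVec_add, ha, hb] at hc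
    have h1 := congrFun hc i
    have h2 := congrFun hc j
    simp [hij, hij.symm] at h1 h2
    exact ⟨c, h1, h2⟩
  have hab : a = b := by
    obtain ⟨c, rfl, h⟩ := hpair 1
    simpa using h
  have ha0 : a ≠ 0 := by
    rintro rfl
    have := mulVec_coordMap_ne_zero A θ (v := Pi.single i 1) (by simp)
    rw [hcoord, map_one, ha] at this
    simp at this
  have hθ : θ = 1 := by
    refine RingEquiv.ext fun t => ?_
    obtain ⟨c, rfl, h⟩ := hpair t
    rw [← hab, mul_comm] at h
    exact (mul_right_cancel₀ ha0 h).symm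
  subst hθ
  exact SemidirectProduct.ext (mk_eq_one_of_smul_eq A key) rfl

theorem exists_pointAction_eq (hι : 2 < Fintype.card ι) {α : Equiv.Perm (ℙ F (ι → F))}
    (hα : α ∈ linePreserving F (ι → F)) : ∃ g, pointAction ι F g = α := by
  classical
  have hdim : ∀ v w : ι → F, Submodule.span F {v, w} ≠ ⊤ := by
    intro v w h
    have h1 := finrank_span_finset_le_card (R := F) ({v, w} : Finset (ι → F))
    rw [Finset.coe_pair, Set.finrank, h, finrank_top, Module.finrank_fintype_fun_eq_card] at h1
    exact absurd (h1.trans Finset.card_le_two) (by omega)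
  obtain ⟨θ, g, hg, h⟩ := exists_semilinear_of_mem_linePreserving hdim hα
  -- The columns are the images of the standard basis, so `g` is θ on coordinates followed by `M`.
  let M : Matrix ι ι F := Matrix.of fun i j => g (Pi.single j 1) i
  have hM : ∀ v, M.mulVec (coordMap ι θ v) = g v := by
    intro v
    have hv : v = ∑ j, v j • Pi.single j (1 : F) := by
      simpa [← Pi.single_smul] using (Finset.univ_sum_single v).symm
    conv_rhs => rw [hv, map_sum]
    funext i
    rw [Finset.sum_apply]
    refine Finset.sum_congr rfl fun j _ => ?_
    rw [map_smulₛₗ]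
    exact mul_comm _ _
  have hunit : IsUnit M := by
    rw [← Matrix.mulVec_injective_iff_isUnit]
    refine (injective_iff_map_eq_zero M.mulVecLin).2 fun y hy => ?_
    have hy' : coordMap ι θ (coordMap ι θ.symm y) = y :=
      funext fun i => θ.apply_symm_apply (y i)
    by_contra hne
    refine hg (coordMap ι θ.symm y) (fun h0 => hne ?_) ?_
    · rw [← hy', h0, map_zero]
    · rw [← hM, hy']
      exact hy
  refine ⟨⟨Matrix.ProjGenLinGroup.mk hunit.unit, θ⟩, Equiv.ext <|
    Projectivization.ind fun v hv => ?_⟩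
  rw [pointAction_mk _ _ v hv (mulVec_coordMap_ne_zero _ _ hv), h]
  congr 1
  exact hM v

/-- In dimension at least two, `PΓL` is the group of permutations of the points that preserve
collinearity. -/
def pointActionEquiv (hι : 2 < Fintype.card ι) :
    Matrix.ProjGenLinGroup ι F ⋊[pglAction ι F] RingAut F ≃* linePreserving F (ι → F) :=
  MulEquiv.ofBijective ((pointAction ι F).codRestrict _ pointAction_mem_linePreserving)
    ⟨by
      have : Nontrivial ι := Fintype.one_lt_card_iff_nontrivial.1 (by omega)
      exact fun g g' h => pointAction_injective (congrArg Subtype.val h),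
    fun α => by
      obtain ⟨g, hg⟩ := exists_pointAction_eq hι α.2
      exact ⟨g, Subtype.ext hg⟩⟩

end SemilinearAction

/-! ### Continuity -/

section Continuity

open Projectivization Topology

theorem isQuotientMap_mk' (K V : Type*) [Field K] [AddCommGroup V] [Module K V]
    [TopologicalSpace V] : IsQuotientMap (mk' K : { v : V // v ≠ 0 } → ℙ K V) :=
  isQuotientMap_quot_mk

theorem continuous_map {K V : Type*} [Field K] [AddCommGroup V] [Module K V]
    [TopologicalSpace V] {σ : K →+* K} {f : V →ₛₗ[σ] V} (hf : Function.Injective f)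
    (hcont : Continuous f) : Continuous (map f hf) := by
  rw [(isQuotientMap_mk' K V).continuous_iff]
  exact (isQuotientMap_mk' K V).continuous.comp
    (Continuous.subtype_mk (hcont.comp continuous_subtype_val) _ :
      Continuous fun v : { v : V // v ≠ 0 } => (⟨f v, fun h => v.2 (hf (by rw [h, map_zero]))⟩ :
        { v : V // v ≠ 0 }))

variable {ι F : Type*} [Field F]

/-- The quotient of two homogeneous coordinates. -/
def coordRatio (i j : ι) (x : ℙ F (ι → F)) : F := x.rep j / x.rep i

theorem coordRatio_mk (i j : ι) (v : ι → F) (hv : v ≠ 0) :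
    coordRatio i j (mk F v hv) = v j / v i := by
  obtain ⟨a, ha⟩ := exists_smul_eq_mk_rep F v hv
  rw [coordRatio, ← ha]
  exact mul_div_mul_left _ _ a.ne_zero

theorem rep_mk_apply_ne_zero_iff (i : ι) (v : ι → F) (hv : v ≠ 0) :
    (mk F v hv).rep i ≠ 0 ↔ v i ≠ 0 := by
  obtain ⟨a, ha⟩ := exists_smul_eq_mk_rep F v hv
  rw [← ha]
  exact (mul_ne_zero_iff_left a.ne_zero)

variable [TopologicalSpace F]

/-- The chart where the `i`-th coordinate is nonzero is open because `F` is Hausdorff, so continuity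
can be tested upstairs on `v j / v i`. -/
theorem continuousOn_coordRatio [IsTopologicalDivisionRing F] [T2Space F] (i j : ι) :
    ContinuousOn (coordRatio i j) {x : ℙ F (ι → F) | x.rep i ≠ 0} := by
  have hpre : mk' F ⁻¹' {x : ℙ F (ι → F) | x.rep i ≠ 0} = {v | v.1 i ≠ 0} :=
    Set.ext fun v => rep_mk_apply_ne_zero_iff i v.1 v.2
  have hi : ∀ k, Continuous fun v : { v : ι → F // v ≠ 0 } => v.1 k := fun k =>
    (continuous_apply k).comp continuous_subtype_val
  have hopen : IsOpen {x : ℙ F (ι → F) | x.rep i ≠ 0} := by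
    rw [← (isQuotientMap_mk' F (ι → F)).isOpen_preimage, hpre]
    exact isOpen_ne_fun (hi i) continuous_const
  rw [(isQuotientMap_mk' F (ι → F)).continuousOn_isOpen_iff hopen, hpre]
  refine ContinuousOn.congr (f := fun v : { v : ι → F // v ≠ 0 } => v.1 j / v.1 i) ?_ fun v _ => coordRatio_mk i j v.1 v.2
  exact (hi j).continuousOn.div (hi i).continuousOn fun v hv => hv

theorem continuous_autAction_iff [IsTopologicalDivisionRing F] [T2Space F] [Nontrivial ι]
    (θ : RingAut F) : Continuous (autAction ι F θ) ↔ Continuous θ := by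
  classical
  constructor
  · intro h
    obtain ⟨i, j, hij⟩ := exists_pair_ne ι
    -- An affine line inside the chart of `i`: its `j`-th coordinate is `t`, all others are 1, so
    -- after applying θ the ratio reads off `θ t`.
    let c : F → ι → F := fun t => Function.update (fun _ => 1) j t
    have hci : ∀ t, c t i = 1 := fun t => Function.update_of_ne hij _ _
    have hcj : ∀ t, c t j = t := fun t => Function.update_self _ _ _
    have hc0 : ∀ t, c t ≠ 0 := fun t h0 => by simpa [hci] using congrFun h0 i
    have hcc : Continuous c := continuous_const.update j continuous_id
    have hc : Continuous fun t => mk F (c t) (hc0 t) :=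
      (isQuotientMap_mk' F (ι → F)).continuous.comp (hcc.subtype_mk hc0)
    have hθ : ∀ t, coordRatio i j (autAction ι F θ (mk F (c t) (hc0 t))) = θ t := by
      intro t
      rw [autAction_mk, coordRatio_mk]
      change θ (c t j) / θ (c t i) = θ t
      rw [hci, hcj, map_one, div_one]
    have hcomp := (continuousOn_coordRatio (F := F) i j).comp_continuous (h.comp hc) fun t => by
      change (autAction ι F θ (mk F (c t) (hc0 t))).rep i ≠ 0
      rw [autAction_mk, rep_mk_apply_ne_zero_iff]
      change θ (c t i) ≠ 0
      simp [hci]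
    exact hcomp.congr hθ
  · intro h
    exact continuous_map (coordMap_injective θ)
      (continuous_pi fun i => h.comp (continuous_apply i))

variable [Fintype ι] [DecidableEq ι]

theorem continuous_pgl_smul [IsTopologicalRing F] (g : Matrix.ProjGenLinGroup ι F) :
    Continuous fun x : ℙ F (ι → F) => g • x := by
  induction g using Matrix.ProjGenLinGroup.induction_on with | mk A =>
  exact continuous_map (f := A.1.mulVecLin) (Matrix.mulVec_injective_iff_isUnit.2 A.isUnit)
    (continuous_const.matrix_mulVec continuous_id)

/-- Both the matrix part and its inverse act continuously, so the matrix part can be stripped off.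
-/
theorem continuous_pointAction_iff [IsTopologicalDivisionRing F] [T2Space F] [Nontrivial ι]
    (g : Matrix.ProjGenLinGroup ι F ⋊[pglAction ι F] RingAut F) :
    Continuous (pointAction ι F g) ↔ Continuous g.right := by
  rw [← continuous_autAction_iff (ι := ι)]
  refine ⟨fun h => ((continuous_pgl_smul g.left⁻¹).comp h).congr fun x => ?_,
    fun h => (continuous_pgl_smul g.left).comp h⟩
  exact inv_smul_smul g.left (autAction ι F g.right x)

end Continuity

/-! ### The isomorphisms -/

section Isomorphisms

/-- The restriction of an isomorphism to corresponding submonoids. -/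
def _root_.MulEquiv.restrictSubmonoids {M N : Type*} [Monoid M] [Monoid N] (e : M ≃* N)
    {S : Submonoid M} {T : Submonoid N} (h : ∀ x, x ∈ S ↔ e x ∈ T) : S ≃* T :=
  { e.toEquiv.subtypeEquiv h with
    map_mul' := fun x y => Subtype.ext (map_mul e x.1 y.1) }

variable (n : ℕ) (F : Type*) [Field F]

/-- The elements of `PΓL` whose field automorphism is a homeomorphism. -/
def PGammaLContSubgroup [TopologicalSpace F] : Subgroup (PGammaL n F) :=
  (continuousRingAut F).comap SemidirectProduct.rightHom

/-- `PΓL_τ` as a subgroup of `PΓL`. -/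
def PGammaLContEquiv [TopologicalSpace F] : PGammaLContSubgroup n F ≃* PGammaLCont n F where
  toFun g := ⟨g.1.left, ⟨g.1.right, g.2⟩⟩
  invFun g := ⟨⟨g.left, g.right.1⟩, g.right.2⟩
  left_inv _ := rfl
  right_inv _ := rfl
  map_mul' _ _ := rfl

variable {n}

/-- The collineation group of a projective space of dimension at least two is `PΓL`. -/
def collineationGroupEquiv (hn : 1 < n) :
    collineationGroup F (Fin (n + 1) → F) ≃* PGammaL n F :=
  (collineationEquiv F (Fin (n + 1) → F)).trans (pointActionEquiv (by simp; omega)).symm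

theorem pointAction_collineationGroupEquiv (hn : 1 < n)
    (g : collineationGroup F (Fin (n + 1) → F)) :
    pointAction (Fin (n + 1)) F (collineationGroupEquiv F hn g) = g.1.1 := by
  have h := congrArg Subtype.val ((pointActionEquiv (ι := Fin (n + 1)) (F := F)
    (by simp; omega)).apply_symm_apply (collineationEquiv F (Fin (n + 1) → F) g))
  exact h

theorem continuous_collineation_iff [TopologicalSpace F] [IsTopologicalDivisionRing F]
    [T2Space F] (hn : 1 < n) (g : collineationGroup F (Fin (n + 1) → F)) :
    Continuous g.1.1 ↔ Continuous (collineationGroupEquiv F hn g).right := by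
  have : Nontrivial (Fin (n + 1)) := Fin.nontrivial_iff_two_le.2 (by omega)
  rw [← pointAction_collineationGroupEquiv F hn, continuous_pointAction_iff]

/-- The automorphism component of an inverse in the semidirect product is the inverse automorphism.
-/
theorem continuous_collineation_symm_iff [TopologicalSpace F] [IsTopologicalDivisionRing F]
    [T2Space F] (hn : 1 < n) (g : collineationGroup F (Fin (n + 1) → F)) :
    Continuous g.1.1.symm ↔ Continuous (collineationGroupEquiv F hn g).right.symm := by
  have h := continuous_collineation_iff F hn g⁻¹
  rw [map_inv] at h
  exact h

end Isomorphisms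

end ProjCol

end

theorem mainTheorem8 (n : ℕ) (hn : 1 < n) (F : Type*) [Field F] :
    Nonempty (ProjCol.collineationGroup F (Fin (n + 1) → F) ≃* ProjCol.PGammaL n F) ∧
    ∀ [TopologicalSpace F] [IsTopologicalDivisionRing F] [T2Space F],
      Nonempty (ProjCol.continuousCollineationGroup F (Fin (n + 1) → F)
        ≃* ProjCol.PGammaLCont n F) ∧
      Nonempty (ProjCol.continuousCollineationMonoid F (Fin (n + 1) → F)
        ≃* ProjCol.PGammaLContMonoid n F) := by
  refine ⟨⟨ProjCol.collineationGroupEquiv F hn⟩, ⟨?_⟩, ⟨?_⟩⟩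
  · exact (MulEquiv.restrictSubmonoids (ProjCol.collineationGroupEquiv F hn)
      (S := (ProjCol.continuousCollineationGroup F (Fin (n + 1) → F)).toSubmonoid)
      (T := (ProjCol.PGammaLContSubgroup n F).toSubmonoid) fun g =>
        and_congr (ProjCol.continuous_collineation_iff F hn g)
          (ProjCol.continuous_collineation_symm_iff F hn g)).trans (ProjCol.PGammaLContEquiv n F)
  · exact MulEquiv.restrictSubmonoids (ProjCol.collineationGroupEquiv F hn) fun g =>
      ProjCol.continuous_collineation_iff F hn g
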